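/- **Setting.** Let $\mathcal X\subseteq\mathbb R^d$ ($d\ge 1$), let $P_X$ be a probability measure on $\mathcal X$, and let $\mathcal H$ be a reproducing kernel Hilbert space of real functions on $\mathcal X$ whose kernel has the expansion $K(x,x')=\sum_{i\ge1}\mu_i\phi_i(x)\phi_i(x')$ for all $x,x'\in\mathcal X$, where $\mu_1\ge\mu_2\ge\dots\ge0$ and $(\phi_i)$ is an orthonormal basis of $L^2(P_X)$. Assume $\sup_i\sup_{x\in\mathcal X}|\phi_i(x)|<\infty$, $\sum_i\mu_i<\infty$, and that there is a constant $C_0$ with $\sum_{i>k}\mu_i\le C_0\,k\mu_k$ for all $k\ge1$. For $\lambda>0$ let $s_\lambda$ be the number of $\mu_i$ greater than $\lambda$. For every $n$ let $\mathbf x=(x_1,\dots,x_n)$ be i.i.d. with law $P_X$, let $S$ be a random real $s\times n$ matrix ($s=s(n)$; $S$ may depend on $\mathbf x$), and let $y_i=f(x_i)+\epsilon_i$, where the $\epsilon_i$ are i.i.d. $N(0,1)$ and independent of $(\mathbf x,S)$; $P_f(\cdot\mid\mathbf x,S)$ denotes the conditional law of $\mathbf y=(y_1,\dots,y_n)^\top$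 given $(\mathbf x,S)$. Put $\|g\|_n^2=\frac1n\sum_{i=1}^n g(x_i)^2$ and $\mathbf K=[n^{-1}K(x_i,x_j)]_{i,j}$. **Test.** Let $\lambda=\lambda_n>0$, and let $\widehat f_R=\sum_{i=1}^n(S^\top\widehat\beta)_iK(\cdot,x_i)$, where $\widehat\beta\in\mathbb R^s$ minimizes $\beta^\top S\mathbf K^2S^\top\beta-\frac2n\beta^\top S\mathbf K\mathbf y+\lambda\beta^\top S\mathbf KS^\top\beta$ (all minimizers give the same $\widehat f_R$). Let $T_{n,\lambda}=\|\widehat f_R\|_n^2$, let $\mu_{n,\lambda}$ and $\sigma^2_{n,\lambda}$ be its conditional mean and variance given $(\mathbf x,S)$ when $f=0$, and for a fixed level $\alpha\in(0,1)$ let $\phi_{n,\lambda}=I(|T_{n,\lambda}-\mu_{n,\lambda}|\ge z_{1-\alpha/2}\,\sigma_{n,\lambda})$, where $z_p$ is the $p$-quantile of $N(0,1)$. **Assumption A2.** Write $\mathbf K=UDU^\top$ with $U$ orthogonal and $D=\operatorname{diag}(\widehat\mu_1\ge\dots\ge\widehat\mu_n\ge0)$; let $U_1$ consist of the columns of $U$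 with $\widehat\mu_i>\lambda$, and $U_2,D_2$ of the columns and eigenvalues with $\widehat\mu_i\le\lambda$. Call $S$ $\mathbf K$-satisfiable with constant $c$ if $\|(SU_1)^\top SU_1-I\|_{\rm op}\le\frac12$ and $\|SU_2D_2^{1/2}\|_{\rm op}\le c\lambda^{1/2}$. Assume that (a) $s\ge\delta s_\lambda$ for all $n\geq 1$, for a constant $\delta>0$; (b) there are $c\in(0,\infty)$ and $c_1,c_2\in(0,\infty]$, not depending on $n$, such that for all $n\ge1$ $$P\bigl(P(S\text{ is }\mathbf K\text{-satisfiable with constant }c\mid\mathbf x)\ge1-e^{-c_1s}\bigr)\ge1-e^{-c_2s_\lambda}$$ (with $e^{-\infty}=0$ and $\infty\cdot0=0$). **Theorem 4.6.** Suppose that $\frac1n<\lambda_n$ for all $n\ge1$, that $\lambda_n\to0$ as $n\to\infty$, and that Assumption A2 holds. Let $R>0$ and $\mathcal B=\{f\in\mathcal H:\|f\|_{\mathcal H}\le R\}$. Then for every $\varepsilon>0$ there are positive constants $C_\varepsilon$ and $N_\varepsilon$ such that, for every $n\ge N_\varepsilon$, with probability at least $1-e^{-c_1s}-e^{-c_2s_\lambda}$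 (that is, on a measurable event of at least this probability), $$\inf_{f\in\mathcal B,\ \|f\|_n\ge C_\varepsilon d_{n,\lambda}}P_f(\phi_{n,\lambda}=1\mid\mathbf x,S)\ge1-\varepsilon,\qquad d_{n,\lambda}=\sqrt{\lambda+\sigma_{n,\lambda}}.$$ -/

import Mathlib

open MeasureTheory ProbabilityTheory Filter
open scoped ENNReal Topology Matrix

noncomputable section

namespace RandProjTest

/-- The scalar reproducing kernel `K(x, x')` of a real-valued reproducing kernel Hilbert space
(Mathlib's kernel takes values in the continuous linear maps `ℝ → ℝ`, i.e. in `ℝ`). -/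
def rkhsKernel (H : Type*) {X : Type*} [NormedAddCommGroup H] [InnerProductSpace ℝ H]
    [CompleteSpace H] [RKHS ℝ H X ℝ] (x x' : X) : ℝ :=
  RKHS.kernel H x x' 1

/-- The spectral expansion `K(x, x') = ∑ μ_i φ_i(x) φ_i(x')` with ordered nonnegative eigenvalues
and with eigenfunctions forming an orthonormal basis of `L²(PX)`.  Indices start at `0` here:
`μ i` and `φ i` are the `(i+1)`-st eigenvalue and eigenfunction.  (The relation
`⟪φ_i, φ_j⟫_H = δ_ij / μ_i` for `μ_i > 0` is a consequence.) -/
structure IsMercerExpansion {X : Type*} [MeasurableSpace X] (K : X → X → ℝ) (PX : Measure X)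
    (μ : ℕ → ℝ) (φ : ℕ → X → ℝ) : Prop where
  antitone : Antitone μ
  nonneg : ∀ i, 0 ≤ μ i
  measurable : ∀ i, Measurable (φ i)
  memLp : ∀ i, MemLp (φ i) 2 PX
  orthonormal : ∀ i j, ∫ t, φ i t * φ j t ∂PX = if i = j then 1 else 0
  complete : ∀ g : X → ℝ, MemLp g 2 PX → (∀ i, ∫ t, g t * φ i t ∂PX = 0) → g =ᵐ[PX] 0
  hasSum : ∀ t t', HasSum (fun i => μ i * φ i t * φ i t') (K t t')

/-- The eigenfunctions are uniformly bounded and `∑_{i > k} μ_i ≤ C k μ_k` for all `k ≥ 1`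
(1-based indices; with the 0-based indices used here, `k = j + 1` and `μ_k` is `μ j`). -/
structure EigenRegularity {X : Type*} (μ : ℕ → ℝ) (φ : ℕ → X → ℝ) : Prop where
  bounded : ∃ cK : ℝ, ∀ i t, |φ i t| ≤ cK
  summable : Summable μ
  tail : ∃ C : ℝ, ∀ j : ℕ, ∑' i : ℕ, μ (j + 1 + i) ≤ C * ((j + 1 : ℕ) * μ j)

/-- `s_λ`, the number of eigenvalues greater than `λ`. -/
def effDim (μ : ℕ → ℝ) (lam : ℝ) : ℕ := Set.ncard {i | lam < μ i}

/-- The empirical kernel matrix `[n⁻¹ K(x_i, x_j)]`. -/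
def kernelMatrix {X : Type*} {n : ℕ} (K : X → X → ℝ) (x : Fin n → X) : Matrix (Fin n) (Fin n) ℝ :=
  Matrix.of fun i j => (n : ℝ)⁻¹ * K (x i) (x j)

/-- The operator norm `max ‖A v‖₂ / ‖v‖₂` of a rectangular matrix. -/
def opNorm {m n : Type*} [Fintype m] [Fintype n] [DecidableEq n] (A : Matrix m n ℝ) : ℝ :=
  ‖LinearMap.toContinuousLinearMap (Matrix.toEuclideanLin A)‖

/-- `S` is `K`-satisfiable at level `lam` with constant `c`.  Here `A = U D Uᵀ` is the
singular value decomposition of the kernel matrix with decreasing `D`; the first block `U₁` consists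
of the columns whose eigenvalue exceeds `lam` (the first `ŝ_λ` columns), `U₂` and `D₂` of the rest.
The two norms do not depend on the choice of `U`. -/
def IsKSatisfiable {n s : ℕ} (c lam : ℝ) (A : Matrix (Fin n) (Fin n) ℝ)
    (S : Matrix (Fin s) (Fin n) ℝ) : Prop :=
  ∃ (U : Matrix (Fin n) (Fin n) ℝ) (D : Fin n → ℝ),
    U * Uᵀ = 1 ∧ Antitone D ∧ (∀ i, 0 ≤ D i) ∧ A = U * Matrix.diagonal D * Uᵀ ∧
    let U₁ : Matrix (Fin n) {i // lam < D i} ℝ := U.submatrix id Subtype.val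
    let U₂ : Matrix (Fin n) {i // ¬ lam < D i} ℝ := U.submatrix id Subtype.val
    let D₂ : {i // ¬ lam < D i} → ℝ := fun i => D i
    opNorm ((S * U₁)ᵀ * (S * U₁) - 1) ≤ 1 / 2 ∧
    opNorm (S * U₂ * Matrix.diagonal (fun i => √(D₂ i))) ≤ c * √lam

/-- `exp(-a)` for `a ∈ [0, ∞]`, with `exp(-∞) = 0`. -/
def expNeg (a : ℝ≥0∞) : ℝ := if a = ∞ then 0 else Real.exp (-a.toReal)

/-- The event `A` is of `(a, b)`-type with respect to the design `x`:
`P(P(A | x) ≥ 1 - exp(-a)) ≥ 1 - exp(-b)`. -/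
def IsEventType {Ω E : Type*} [MeasurableSpace Ω] [mE : MeasurableSpace E] (P : Measure Ω)
    (x : Ω → E) (A : Set Ω) (a b : ℝ≥0∞) : Prop :=
  1 - expNeg b ≤ P.real {ω | 1 - expNeg a ≤ (P⟦A | MeasurableSpace.comap x mE⟧) ω}

/-- The empirical norm `‖g‖_n = (n⁻¹ ∑ g(x_i)²)^{1/2}`. -/
def empNorm {X : Type*} {n : ℕ} (x : Fin n → X) (g : X → ℝ) : ℝ :=
  √((n : ℝ)⁻¹ * ∑ i, g (x i) ^ 2)

/-- The criterion
`βᵀ (S K)(K Sᵀ) β - (2/n) βᵀ S K y + λ βᵀ S K Sᵀ β` of randomly projected kernel ridge regression,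
`A` being the kernel matrix. -/
def projObjective {n s : ℕ} (lam : ℝ) (A : Matrix (Fin n) (Fin n) ℝ)
    (S : Matrix (Fin s) (Fin n) ℝ) (y : Fin n → ℝ) (β : Fin s → ℝ) : ℝ :=
  β ⬝ᵥ (((S * A) * (A * Sᵀ)) *ᵥ β) - 2 / (n : ℝ) * (β ⬝ᵥ ((S * A) *ᵥ y))
    + lam * (β ⬝ᵥ ((S * A * Sᵀ) *ᵥ β))

open Classical in
/-- A minimizer `β̂` of the criterion.  A minimizer always exists for `lam > 0`; if
`S K² Sᵀ + λ S K Sᵀ` is invertible it is unique, namely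
`n⁻¹ (S K² Sᵀ + λ S K Sᵀ)⁻¹ S K y`, and otherwise all minimizers give the same estimator. -/
def projCoeff {n s : ℕ} (lam : ℝ) (A : Matrix (Fin n) (Fin n) ℝ)
    (S : Matrix (Fin s) (Fin n) ℝ) (y : Fin n → ℝ) : Fin s → ℝ :=
  if h : ∃ β, ∀ β', projObjective lam A S y β ≤ projObjective lam A S y β' then h.choose else 0

/-- The estimator `f̂_R = ∑ (Sᵀ β̂)_i K(·, x_i)`. -/
def projEstimator {X : Type*} {n s : ℕ} (K : X → X → ℝ) (lam : ℝ) (x : Fin n → X)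
    (S : Matrix (Fin s) (Fin n) ℝ) (y : Fin n → ℝ) (t : X) : ℝ :=
  ∑ i, (Sᵀ *ᵥ projCoeff lam (kernelMatrix K x) S y) i * K t (x i)

/-- The test statistic `T_{n,λ} = ‖f̂_R‖_n²`. -/
def testStat {X : Type*} {n s : ℕ} (K : X → X → ℝ) (lam : ℝ) (x : Fin n → X)
    (S : Matrix (Fin s) (Fin n) ℝ) (y : Fin n → ℝ) : ℝ :=
  empNorm x (projEstimator K lam x S y) ^ 2

/-- The conditional law `P_f(· | x, S)` of the responses `y_i = f(x_i) + ε_i`, where the noise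
variables `ε_i` are i.i.d. standard Gaussian and independent of `(x, S)`. -/
def condLaw {X : Type*} {n : ℕ} (f : X → ℝ) (x : Fin n → X) : Measure (Fin n → ℝ) :=
  Measure.map (fun e i => f (x i) + e i) (Measure.pi fun _ : Fin n => gaussianReal 0 1)

/-- `μ_{n,λ} = E(T_{n,λ} | x, S)` under the null hypothesis `f = 0`. -/
def nullMean {X : Type*} {n s : ℕ} (K : X → X → ℝ) (lam : ℝ) (x : Fin n → X)
    (S : Matrix (Fin s) (Fin n) ℝ) : ℝ :=
  ∫ y, testStat K lam x S y ∂(condLaw (fun _ => 0) x)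

/-- `σ_{n,λ}`, the square root of `Var(T_{n,λ} | x, S)` under the null hypothesis `f = 0`. -/
def nullSd {X : Type*} {n s : ℕ} (K : X → X → ℝ) (lam : ℝ) (x : Fin n → X)
    (S : Matrix (Fin s) (Fin n) ℝ) : ℝ :=
  √(variance (fun y => testStat K lam x S y) (condLaw (fun _ => 0) x))

/-- The `p`-quantile of the standard Gaussian distribution. -/
def stdNormalQuantile (p : ℝ) : ℝ := sInf {t | p ≤ cdf (gaussianReal 0 1) t}

/-- The event `φ_{n,λ} = 1`: the level `α` test rejects on the responses `y`. -/
def Rejects {X : Type*} {n s : ℕ} (α : ℝ) (K : X → X → ℝ) (lam : ℝ) (x : Fin n → X)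
    (S : Matrix (Fin s) (Fin n) ℝ) (y : Fin n → ℝ) : Prop :=
  stdNormalQuantile (1 - α / 2) * nullSd K lam x S ≤ |testStat K lam x S y - nullMean K lam x S|

/-- The conditional power `P_f(φ_{n,λ} = 1 | x, S)`. -/
def condPower {X : Type*} {n s : ℕ} (α : ℝ) (K : X → X → ℝ) (lam : ℝ) (f : X → ℝ) (x : Fin n → X)
    (S : Matrix (Fin s) (Fin n) ℝ) : ℝ :=
  (condLaw f x).real {y | Rejects α K lam x S y}

/-- The separation rate `d_{n,λ} = (λ + σ_{n,λ})^{1/2}`. -/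
def sepRate {X : Type*} {n s : ℕ} (K : X → X → ℝ) (lam : ℝ) (x : Fin n → X)
    (S : Matrix (Fin s) (Fin n) ℝ) : ℝ :=
  √(lam + nullSd K lam x S)

end RandProjTest

end

namespace RandProjTest

/-! Everything is deterministic on the satisfiable event, apart from two applications of Chebyshev's
inequality to the noise. Write `v` for the values of `f` at the design and `e` for the noise.

Completing the square turns the ridge criterion into a distance to a subspace of ℝⁿ × ℝⁿ. Hence the
fitted values are `L y` with `L` a linear contraction, and `T = ‖L y‖² / n` (`exists_fittedValues`).
Expanding at `y = v + e` gives `T = n⁻¹ (‖L v‖² + 2⟪L v, L e⟫) + T₀`, where `T₀` is the null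
statistic. With probability at least `1 - 2/r²`, both `|T₀ - E T₀| < r (λ + σ)` and `|⟪L v, L e⟫| <
r ‖L v‖`, so the test rejects once `‖L v‖` is a large multiple of `ρ = √(n (λ + σ))`; here `nλ > 1`
gives `ρ ≥ 1`.

Since `‖v‖ ≥ C ρ`, it remains to bound the bias: `‖v - L v‖² ≤ nλ (3 + 6c²) ‖f‖²`. The projection
property reduces this to exhibiting one good `β`, and satisfiability supplies it
(`exists_coeff_approx`): eigendirections above `λ` are matched exactly, those below cost order `λ`.
-/

/-! ### Matrix norms and well-conditioned Gram matrices. -/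

theorem dotProduct_self_eq_norm_sq {m : Type*} [Fintype m] (v : m → ℝ) :
    v ⬝ᵥ v = ‖WithLp.toLp 2 v‖ ^ 2 := by
  rw [EuclideanSpace.real_norm_sq_eq]
  exact Finset.sum_congr rfl fun i _ => (sq (v i)).symm

theorem abs_dotProduct_le {m : Type*} [Fintype m] (v w : m → ℝ) :
    |v ⬝ᵥ w| ≤ ‖WithLp.toLp 2 v‖ * ‖WithLp.toLp 2 w‖ := by
  have h := abs_real_inner_le_norm (WithLp.toLp 2 w) (WithLp.toLp 2 v)
  rw [EuclideanSpace.inner_toLp_toLp] at h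
  simpa [mul_comm] using h

theorem norm_mulVec_le_opNorm {m n : Type*} [Fintype m] [Fintype n] [DecidableEq n]
    (A : Matrix m n ℝ) (v : n → ℝ) :
    ‖WithLp.toLp 2 (A *ᵥ v)‖ ≤ opNorm A * ‖WithLp.toLp 2 v‖ := by
  have h := (LinearMap.toContinuousLinearMap (Matrix.toEuclideanLin A)).le_opNorm (WithLp.toLp 2 v)
  simpa [opNorm, Matrix.toLpLin_apply] using h

theorem opNorm_nonneg {m n : Type*} [Fintype m] [Fintype n] [DecidableEq n]
    (A : Matrix m n ℝ) : 0 ≤ opNorm A := norm_nonneg _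

/-- Cauchy–Schwarz applied to `‖Aᵀv‖² = ⟨v, A(Aᵀv)⟩`, then division by `‖Aᵀv‖`. -/
theorem norm_transpose_mulVec_le_opNorm {m n : Type*} [Fintype m] [Fintype n] [DecidableEq n]
    (A : Matrix m n ℝ) (v : m → ℝ) :
    ‖WithLp.toLp 2 (Aᵀ *ᵥ v)‖ ≤ opNorm A * ‖WithLp.toLp 2 v‖ := by
  set u := Aᵀ *ᵥ v with hu
  have h1 : ‖WithLp.toLp 2 u‖ ^ 2 = v ⬝ᵥ (A *ᵥ u) := by
    rw [← dotProduct_self_eq_norm_sq, Matrix.dotProduct_mulVec v, ← Matrix.mulVec_transpose, ← hu]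
  have h2 := (le_abs_self _).trans (abs_dotProduct_le v (A *ᵥ u))
  have h3 := mul_le_mul_of_nonneg_left (norm_mulVec_le_opNorm A u) (norm_nonneg (WithLp.toLp 2 v))
  have h5 := opNorm_nonneg A
  rcases (norm_nonneg (WithLp.toLp 2 u)).eq_or_lt with h4 | h4
  · rw [← h4]; positivity
  · refine le_of_mul_le_mul_right ?_ h4
    nlinarith

/-- A Gram matrix within `1/2` of the identity is invertible, and the preimage `V p` of `q` under
`Vᵀ` obtained from it is at most `√2` times as long as `q`. -/
theorem exists_transpose_mulVec_eq {m n : Type*} [Fintype m] [Fintype n] [DecidableEq n]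
    (V : Matrix m n ℝ) (hV : opNorm (Vᵀ * V - 1) ≤ 1 / 2) (q : n → ℝ) :
    ∃ β : m → ℝ, Vᵀ *ᵥ β = q ∧ ‖WithLp.toLp 2 β‖ ^ 2 ≤ 2 * ‖WithLp.toLp 2 q‖ ^ 2 := by
  -- As a quadratic form `VᵀV ≥ 1/2`; this gives injectivity, hence surjectivity in finite
  -- dimension.
  have key : ∀ p : n → ℝ, ‖WithLp.toLp 2 p‖ ^ 2 ≤ 2 * (p ⬝ᵥ ((Vᵀ * V) *ᵥ p)) := by
    intro p
    have h1 := neg_le_of_abs_le (abs_dotProduct_le p ((Vᵀ * V - 1) *ᵥ p))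
    have h2 := norm_mulVec_le_opNorm (Vᵀ * V - 1) p
    rw [Matrix.sub_mulVec, Matrix.one_mulVec, dotProduct_sub, dotProduct_self_eq_norm_sq] at h1
    rw [Matrix.sub_mulVec, Matrix.one_mulVec] at h2
    have h3 := norm_nonneg (WithLp.toLp 2 p)
    nlinarith [mul_le_mul_of_nonneg_left h2 h3, mul_le_mul_of_nonneg_right hV (mul_nonneg h3 h3)]
  have hinj : Function.Injective (Matrix.mulVecLin (Vᵀ * V)) := by
    rw [injective_iff_map_eq_zero]
    intro p hp
    have h := key p
    rw [Matrix.mulVecLin_apply] at hp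
    rw [hp, dotProduct_zero, mul_zero] at h
    have h0 : ‖WithLp.toLp 2 p‖ = 0 := by nlinarith [norm_nonneg (WithLp.toLp 2 p)]
    simpa using h0
  obtain ⟨p, hp⟩ := LinearMap.injective_iff_surjective.mp hinj q
  rw [Matrix.mulVecLin_apply] at hp
  refine ⟨V *ᵥ p, by rw [Matrix.mulVec_mulVec, hp], ?_⟩
  have h1 : ‖WithLp.toLp 2 (V *ᵥ p)‖ ^ 2 = p ⬝ᵥ q := by
    rw [← dotProduct_self_eq_norm_sq, Matrix.dotProduct_mulVec, Matrix.vecMul_mulVec, ← hp,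
      Matrix.dotProduct_mulVec]
  have h2 := key p
  rw [hp] at h2
  have h3 := (le_abs_self _).trans (abs_dotProduct_le p q)
  rw [h1]
  -- `4⟨p,q⟩ ≤ 4‖p‖‖q‖ ≤ ‖p‖² + 4‖q‖² ≤ 2⟨p,q⟩ + 4‖q‖²`.
  nlinarith [norm_nonneg (WithLp.toLp 2 p), norm_nonneg (WithLp.toLp 2 q),
    sq_nonneg (‖WithLp.toLp 2 p‖ - 2 * ‖WithLp.toLp 2 q‖)]

/-! ### Projected ridge regression as an orthogonal projection. -/

/-- The criterion of randomly projected kernel ridge regression completed to a square. -/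
theorem projObjective_eq {n s : ℕ} {lam : ℝ} {A C : Matrix (Fin n) (Fin n) ℝ} (hA : A = Cᵀ * C)
    (S : Matrix (Fin s) (Fin n) ℝ) (y : Fin n → ℝ) (β : Fin s → ℝ) :
    projObjective lam A S y β =
      ‖WithLp.toLp 2 ((n : ℝ)⁻¹ • y) - WithLp.toLp 2 (A *ᵥ (Sᵀ *ᵥ β))‖ ^ 2
        + lam * ‖WithLp.toLp 2 (C *ᵥ (Sᵀ *ᵥ β))‖ ^ 2 - ‖WithLp.toLp 2 ((n : ℝ)⁻¹ • y)‖ ^ 2 := by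
  have hAt : Aᵀ = A := by rw [hA]; simp
  have e1 : β ⬝ᵥ (((S * A) * (A * Sᵀ)) *ᵥ β) = ‖WithLp.toLp 2 (A *ᵥ (Sᵀ *ᵥ β))‖ ^ 2 := by
    rw [← dotProduct_self_eq_norm_sq, ← Matrix.mulVec_mulVec, Matrix.dotProduct_mulVec,
      ← Matrix.mulVec_transpose, Matrix.transpose_mul, hAt, ← Matrix.mulVec_mulVec]
  have e2 : β ⬝ᵥ ((S * A) *ᵥ y) = (A *ᵥ (Sᵀ *ᵥ β)) ⬝ᵥ y := by
    rw [Matrix.dotProduct_mulVec, ← Matrix.mulVec_transpose, Matrix.transpose_mul, hAt,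
      ← Matrix.mulVec_mulVec]
  have e3 : β ⬝ᵥ ((S * A * Sᵀ) *ᵥ β) = ‖WithLp.toLp 2 (C *ᵥ (Sᵀ *ᵥ β))‖ ^ 2 := by
    rw [← dotProduct_self_eq_norm_sq, ← Matrix.mulVec_mulVec, Matrix.dotProduct_mulVec,
      ← Matrix.mulVec_transpose, Matrix.transpose_mul, hAt, ← Matrix.mulVec_mulVec, hA,
      ← Matrix.mulVec_mulVec, dotProduct_comm, Matrix.dotProduct_mulVec, ← Matrix.mulVec_transpose,
      Matrix.transpose_transpose]
  rw [projObjective, e1, e2, e3, norm_sub_sq_real, EuclideanSpace.inner_toLp_toLp]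
  simp only [star_trivial, dotProduct_smul, smul_eq_mul]
  ring

/-- The vector of fitted values of randomly projected kernel ridge regression is a linear
contraction `L` of the responses, and the bias `v - L v` obeys an oracle inequality. -/
theorem exists_fittedValues {n s : ℕ} (hn : 1 ≤ n) {lam : ℝ} (hlam : 0 ≤ lam)
    {A C : Matrix (Fin n) (Fin n) ℝ} (hA : A = Cᵀ * C) (S : Matrix (Fin s) (Fin n) ℝ) :
    ∃ L : EuclideanSpace ℝ (Fin n) →ₗ[ℝ] EuclideanSpace ℝ (Fin n),
      (∀ v, ‖L v‖ ≤ ‖v‖) ∧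
      (∀ v (β : Fin s → ℝ), ‖v - L v‖ ^ 2 ≤ ‖v - WithLp.toLp 2 (A *ᵥ (Sᵀ *ᵥ β))‖ ^ 2
        + lam * ‖WithLp.toLp 2 (C *ᵥ (Sᵀ *ᵥ β))‖ ^ 2) ∧
      ∀ y, WithLp.toLp 2 ((n : ℝ) • (A *ᵥ (Sᵀ *ᵥ projCoeff lam A S y))) = L (WithLp.toLp 2 y) := by
  let E := EuclideanSpace ℝ (Fin n)
  -- The second coordinate carries the penalty, so up to a constant the criterion is the squared
  -- distance from `(y/n, 0)` to `Φ β`.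
  let Φ : (Fin s → ℝ) →ₗ[ℝ] WithLp 2 (E × E) :=
    { toFun := fun β => WithLp.toLp 2 (WithLp.toLp 2 (A *ᵥ (Sᵀ *ᵥ β)),
        √lam • WithLp.toLp 2 (C *ᵥ (Sᵀ *ᵥ β)))
      map_add' := fun a b => by
        simp only [Matrix.mulVec_add, WithLp.toLp_add, smul_add, ← Prod.mk_add_mk]
      map_smul' := fun a b => by
        simp only [Matrix.mulVec_smul, WithLp.toLp_smul, RingHom.id_apply, ← Prod.smul_mk,
          smul_comm (√lam) a] }
  let ι : E →ₗ[ℝ] WithLp 2 (E × E) :=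
    (WithLp.linearEquiv 2 ℝ (E × E)).symm.toLinearMap ∘ₗ LinearMap.inl ℝ E E
  let V : Submodule ℝ (WithLp 2 (E × E)) := LinearMap.range Φ
  let fstL : WithLp 2 (E × E) →ₗ[ℝ] E :=
    { toFun := fun z => z.fst
      map_add' := fun a b => rfl
      map_smul' := fun a b => rfl }
  have hfst : ∀ z : WithLp 2 (E × E), ‖fstL z‖ ^ 2 ≤ ‖z‖ ^ 2 := fun z => by
    rw [WithLp.prod_norm_sq_eq_of_L2]
    exact le_add_of_nonneg_right (sq_nonneg _)
  have hι : ∀ v, ‖ι v‖ ^ 2 = ‖v‖ ^ 2 := fun v => by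
    rw [WithLp.prod_norm_sq_eq_of_L2]; simp [ι]
  have hsub : ∀ v β, ‖ι v - Φ β‖ ^ 2 = ‖v - WithLp.toLp 2 (A *ᵥ (Sᵀ *ᵥ β))‖ ^ 2
      + lam * ‖WithLp.toLp 2 (C *ᵥ (Sᵀ *ᵥ β))‖ ^ 2 := fun v β => by
    rw [WithLp.prod_norm_sq_eq_of_L2]
    simp [ι, Φ, norm_smul, mul_pow, Real.sq_sqrt hlam]
  have hpyth : ∀ z w, w ∈ V →
      ‖z - w‖ ^ 2 = ‖z - V.starProjection z‖ ^ 2 + ‖V.starProjection z - w‖ ^ 2 := by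
    intro z w hw
    have h0 : inner ℝ (z - V.starProjection z) (V.starProjection z - w) = 0 :=
      Submodule.starProjection_inner_eq_zero z _
        (V.sub_mem (Submodule.starProjection_apply_mem V z) hw)
    rw [← sub_add_sub_cancel z (V.starProjection z) w, norm_add_sq_real, h0]
    ring
  refine ⟨fstL ∘ₗ V.starProjection.toLinearMap ∘ₗ ι, fun v => ?_, fun v β => ?_, fun y => ?_⟩
  · refine le_of_sq_le_sq ?_ (norm_nonneg _)
    rw [← hι v]
    refine (hfst _).trans ?_
    have h := hpyth (ι v) 0 V.zero_mem
    rw [sub_zero, sub_zero] at h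
    rw [h]
    exact le_add_of_nonneg_left (sq_nonneg _)
  · rw [← hsub, hpyth (ι v) (Φ β) ⟨β, rfl⟩]
    refine le_trans ?_ (le_add_of_nonneg_right (sq_nonneg _))
    exact hfst (ι v - V.starProjection (ι v))
  · set z := ι (WithLp.toLp 2 ((n : ℝ)⁻¹ • y)) with hz
    have hobj : ∀ β, projObjective lam A S y β =
        ‖z - Φ β‖ ^ 2 - ‖WithLp.toLp 2 ((n : ℝ)⁻¹ • y)‖ ^ 2 := fun β => by
      rw [projObjective_eq hA, hsub]
    obtain ⟨β₀, hβ₀⟩ : ∃ β₀, Φ β₀ = V.starProjection z := Submodule.starProjection_apply_mem V z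
    have hex : ∃ β, ∀ β', projObjective lam A S y β ≤ projObjective lam A S y β' :=
      ⟨β₀, fun β' => by
        rw [hobj, hobj, hβ₀, hpyth z (Φ β') ⟨β', rfl⟩]
        linarith [sq_nonneg ‖V.starProjection z - Φ β'‖]⟩
    have hmin : ∀ β',
        projObjective lam A S y (projCoeff lam A S y) ≤ projObjective lam A S y β' := by
      rw [projCoeff, dif_pos hex]
      exact hex.choose_spec
    -- The chosen minimizer need not be `β₀`, but by Pythagoras its image under `Φ` must be the
    -- projection; so all minimizers give the same fit.
    have h1 := hmin β₀
    rw [hobj, hobj, hβ₀, hpyth z (Φ _) ⟨_, rfl⟩] at h1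
    have h2 : ‖V.starProjection z - Φ (projCoeff lam A S y)‖ = 0 := by
      nlinarith [norm_nonneg (V.starProjection z - Φ (projCoeff lam A S y))]
    have h3 : Φ (projCoeff lam A S y) = V.starProjection z :=
      (sub_eq_zero.mp (norm_eq_zero.mp h2)).symm
    have hn0 : (n : ℝ) ≠ 0 := by positivity
    have h4 : WithLp.toLp 2 y = (n : ℝ) • WithLp.toLp 2 ((n : ℝ)⁻¹ • y) := by
      rw [← WithLp.toLp_smul, smul_inv_smul₀ hn0]
    rw [h4, map_smul, WithLp.toLp_smul]
    congr 1
    exact congrArg fstL h3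

/-! ### Approximation error under satisfiability. -/

theorem sum_eq_sum_subtype_add {n : Type*} [Fintype n] (p : n → Prop) [DecidablePred p]
    (F : n → ℝ) :
    ∑ i, F i = ∑ i : {i // p i}, F i + ∑ i : {i // ¬ p i}, F i :=
  (Fintype.sum_subtype_add_sum_subtype p F).symm

/-- If the projection matrix is satisfiable, then the vectors `Cᵀ g`, where `Cᵀ C` is the spectral
decomposition of the kernel matrix, have small approximation error plus penalty. -/
theorem exists_coeff_approx {n s : ℕ} {c lam : ℝ} (hlam : 0 < lam)
    {U : Matrix (Fin n) (Fin n) ℝ} {D : Fin n → ℝ} (hU : U * Uᵀ = 1) (hD : ∀ i, 0 ≤ D i)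
    {S : Matrix (Fin s) (Fin n) ℝ}
    (h₁ : opNorm ((S * (U.submatrix id Subtype.val : Matrix (Fin n) {i // lam < D i} ℝ))ᵀ
      * (S * (U.submatrix id Subtype.val : Matrix (Fin n) {i // lam < D i} ℝ)) - 1) ≤ 1 / 2)
    (h₂ : opNorm (S * (U.submatrix id Subtype.val : Matrix (Fin n) {i // ¬ lam < D i} ℝ)
      * Matrix.diagonal (fun i : {i // ¬ lam < D i} => √(D i))) ≤ c * √lam)
    {C : Matrix (Fin n) (Fin n) ℝ} (hC : C = Matrix.diagonal (fun i => √(D i)) * Uᵀ)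
    (g : Fin n → ℝ) :
    ∃ β : Fin s → ℝ,
      ‖WithLp.toLp 2 (Cᵀ *ᵥ g) - WithLp.toLp 2 (Cᵀ *ᵥ (C *ᵥ (Sᵀ *ᵥ β)))‖ ^ 2
        + lam * ‖WithLp.toLp 2 (C *ᵥ (Sᵀ *ᵥ β))‖ ^ 2 ≤ lam * (3 + 6 * c ^ 2) * ∑ i, g i ^ 2 := by
  set V₁ := S * (U.submatrix id Subtype.val : Matrix (Fin n) {i // lam < D i} ℝ) with hV₁
  set V₂ := S * (U.submatrix id Subtype.val : Matrix (Fin n) {i // ¬ lam < D i} ℝ)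
    * Matrix.diagonal (fun i : {i // ¬ lam < D i} => √(D i)) with hV₂
  -- Dividing by `√(D i)` makes `C Sᵀ β` equal to `g` on the large eigenvalues. The price is `‖β‖² ≤
  -- 2 ∑ g i² / D i`, at most `2G/λ`, which the factor `c²λ` from `h₂` cancels on the small block.
  obtain ⟨β, hβ, hβn⟩ := exists_transpose_mulVec_eq V₁ h₁ fun i => g i / √(D i)
  refine ⟨β, ?_⟩
  set z := C *ᵥ (Sᵀ *ᵥ β) with hz
  have hzi : ∀ i, z i = √(D i) * (Uᵀ *ᵥ (Sᵀ *ᵥ β)) i := fun i => by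
    rw [hz, hC, ← Matrix.mulVec_mulVec, Matrix.mulVec_diagonal]
  have hz₁ : ∀ i : {i // lam < D i}, z i = g i := fun i => by
    have h := congrFun hβ i
    have e : (V₁ᵀ *ᵥ β) i = (Uᵀ *ᵥ (Sᵀ *ᵥ β)) i := by
      rw [hV₁, Matrix.transpose_mul, ← Matrix.mulVec_mulVec]; rfl
    have hpos : 0 < √(D i) := Real.sqrt_pos.mpr (hlam.trans i.2)
    rw [hzi, ← e, h]
    field_simp
  have hz₂ : ∀ i : {i // ¬ lam < D i}, z i = (V₂ᵀ *ᵥ β) i := fun i => by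
    rw [hzi, hV₂, Matrix.transpose_mul, ← Matrix.mulVec_mulVec, Matrix.diagonal_transpose,
      Matrix.mulVec_diagonal, Matrix.transpose_mul, ← Matrix.mulVec_mulVec]
    rfl
  set G := ∑ i, g i ^ 2 with hG
  have hG₁ : ∑ i : {i // lam < D i}, g i ^ 2 ≤ G := by
    rw [hG, sum_eq_sum_subtype_add (fun i => lam < D i)]
    exact le_add_of_nonneg_right (Finset.sum_nonneg fun _ _ => sq_nonneg _)
  have hG₂ : ∑ i : {i // ¬ lam < D i}, g i ^ 2 ≤ G := by
    rw [hG, sum_eq_sum_subtype_add (fun i => lam < D i)]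
    exact le_add_of_nonneg_left (Finset.sum_nonneg fun _ _ => sq_nonneg _)
  have hq : lam * ∑ i : {i // lam < D i}, (g i / √(D i)) ^ 2 ≤ G := by
    refine le_trans ?_ hG₁
    rw [Finset.mul_sum]
    refine Finset.sum_le_sum fun i _ => ?_
    have hpos : 0 < D i := hlam.trans i.2
    rw [div_pow, Real.sq_sqrt hpos.le, mul_div_assoc', div_le_iff₀ hpos, mul_comm]
    exact mul_le_mul_of_nonneg_left i.2.le (sq_nonneg _)
  have hZ₂ : ∑ i : {i // ¬ lam < D i}, z i ^ 2 ≤ 2 * c ^ 2 * G := by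
    have h := norm_transpose_mulVec_le_opNorm V₂ β
    have h' : ‖WithLp.toLp 2 (V₂ᵀ *ᵥ β)‖ ^ 2 ≤ (c * √lam * ‖WithLp.toLp 2 β‖) ^ 2 :=
      pow_le_pow_left₀ (norm_nonneg _) (h.trans (mul_le_mul_of_nonneg_right h₂ (norm_nonneg _))) 2
    rw [EuclideanSpace.real_norm_sq_eq, mul_pow, mul_pow, Real.sq_sqrt hlam.le] at h'
    rw [EuclideanSpace.real_norm_sq_eq (WithLp.toLp 2 fun i : {i // lam < D i} => _)] at hβn
    calc ∑ i : {i // ¬ lam < D i}, z i ^ 2 = ∑ i, (V₂ᵀ *ᵥ β) i ^ 2 :=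
          Finset.sum_congr rfl fun i _ => by rw [hz₂]
      _ ≤ c ^ 2 * lam * ‖WithLp.toLp 2 β‖ ^ 2 := h'
      _ ≤ c ^ 2 * lam * (2 * ∑ i : {i // lam < D i}, (g i / √(D i)) ^ 2) :=
          mul_le_mul_of_nonneg_left hβn (by positivity)
      _ = 2 * c ^ 2 * (lam * ∑ i : {i // lam < D i}, (g i / √(D i)) ^ 2) := by ring
      _ ≤ 2 * c ^ 2 * G := mul_le_mul_of_nonneg_left hq (by positivity)
  have hpen : ‖WithLp.toLp 2 z‖ ^ 2 ≤ G + 2 * c ^ 2 * G := by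
    rw [EuclideanSpace.real_norm_sq_eq]
    change ∑ i, z i ^ 2 ≤ _
    rw [sum_eq_sum_subtype_add (fun i => lam < D i)]
    refine add_le_add ?_ hZ₂
    rw [Finset.sum_congr rfl fun i _ => by rw [hz₁ i]]
    exact hG₁
  have hCC : C * Cᵀ = Matrix.diagonal D := by
    have hU' : Uᵀ * U = 1 := mul_eq_one_comm.mp hU
    rw [hC, Matrix.transpose_mul, Matrix.transpose_transpose, Matrix.diagonal_transpose,
      Matrix.mul_assoc, ← Matrix.mul_assoc Uᵀ, hU', Matrix.one_mul, Matrix.diagonal_mul_diagonal]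
    simp_rw [Real.mul_self_sqrt (hD _)]
  have herr : ‖WithLp.toLp 2 (Cᵀ *ᵥ g) - WithLp.toLp 2 (Cᵀ *ᵥ z)‖ ^ 2
      = ∑ i, D i * (g i - z i) ^ 2 := by
    rw [← WithLp.toLp_sub, ← Matrix.mulVec_sub, ← dotProduct_self_eq_norm_sq,
      Matrix.dotProduct_mulVec, ← Matrix.mulVec_transpose, Matrix.transpose_transpose,
      Matrix.mulVec_mulVec, hCC]
    refine Finset.sum_congr rfl fun i _ => ?_
    rw [Matrix.mulVec_diagonal, Pi.sub_apply]
    ring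
  have herr' : ∑ i, D i * (g i - z i) ^ 2 ≤ lam * (2 * G + 4 * c ^ 2 * G) := by
    rw [sum_eq_sum_subtype_add (fun i => lam < D i),
      Finset.sum_eq_zero fun (i : {i // lam < D i}) _ => by rw [hz₁ i, sub_self]; ring, zero_add]
    calc ∑ i : {i // ¬ lam < D i}, D i * (g i - z i) ^ 2
        ≤ ∑ i : {i // ¬ lam < D i}, lam * (2 * g i ^ 2 + 2 * z i ^ 2) := by
          refine Finset.sum_le_sum fun i _ => ?_
          refine mul_le_mul (not_lt.mp i.2) ?_ (sq_nonneg _) hlam.le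
          nlinarith [sq_nonneg (g i + z i)]
      _ = lam * (2 * ∑ i : {i // ¬ lam < D i}, g i ^ 2 + 2 * ∑ i : {i // ¬ lam < D i}, z i ^ 2) := by
          rw [← Finset.mul_sum, Finset.sum_add_distrib, ← Finset.mul_sum, ← Finset.mul_sum]
      _ ≤ _ := mul_le_mul_of_nonneg_left (by linarith) hlam.le
  -- The error contributes `2 + 4c²` and the penalty `1 + 2c²`, whence `3 + 6c²`.
  rw [herr]
  have := mul_le_mul_of_nonneg_left hpen hlam.le
  nlinarith

/-! ### Values of RKHS elements at the design points. -/

section RKHS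

variable {H X : Type*} [NormedAddCommGroup H] [InnerProductSpace ℝ H] [CompleteSpace H]
  [RKHS ℝ H X ℝ]

theorem inner_kerFun_kerFun (t t' : X) :
    inner ℝ (RKHS.kerFun H t (1 : ℝ)) (RKHS.kerFun H t' (1 : ℝ)) = rkhsKernel H t t' := by
  rw [RKHS.kerFun_inner, RKHS.kerFun_apply]
  simp [rkhsKernel]

/-- The values at the design points of an element `f` of the reproducing kernel Hilbert space are
`√n Cᵀ g` with `‖g‖ ≤ ‖f‖`, where `Cᵀ C` is the spectral decomposition of the kernel matrix. -/
theorem exists_values_eq_mulVec {n : ℕ} (x : Fin n → X)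
    {U : Matrix (Fin n) (Fin n) ℝ} {D : Fin n → ℝ} (hU : U * Uᵀ = 1) (hD : ∀ i, 0 ≤ D i)
    (hA : kernelMatrix (rkhsKernel H) x = U * Matrix.diagonal D * Uᵀ)
    {C : Matrix (Fin n) (Fin n) ℝ} (hC : C = Matrix.diagonal (fun i => √(D i)) * Uᵀ) (f : H) :
    ∃ g : Fin n → ℝ, ∑ i, g i ^ 2 ≤ ‖f‖ ^ 2 ∧ (fun i => f (x i)) = √(n : ℝ) • (Cᵀ *ᵥ g) := by
  rcases Nat.eq_zero_or_pos n with rfl | hn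
  · exact ⟨0, by simp, Subsingleton.elim _ _⟩
  have hU' : Uᵀ * U = 1 := mul_eq_one_comm.mp hU
  have hn0 : (0 : ℝ) < n := by exact_mod_cast hn
  have hsn : √(n : ℝ) ≠ 0 := (Real.sqrt_pos.mpr hn0).ne'
  set v : Fin n → ℝ := fun i => f (x i) with hv
  -- Empirical eigenfunctions: orthogonal in `H` with `‖ψ i‖² = D i`. The vector `g` holds the
  -- coefficients of `f` along the normalized ones, so Bessel's inequality bounds it.
  let ψ : Fin n → H := fun i => (√(n : ℝ))⁻¹ • ∑ j, U j i • RKHS.kerFun H (x j) (1 : ℝ)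
  have hψf : ∀ i, inner ℝ (ψ i) f = (√(n : ℝ))⁻¹ * (Uᵀ *ᵥ v) i := fun i => by
    simp only [ψ, real_inner_smul_left, sum_inner, RKHS.kerFun_inner]
    congr 1
    refine Finset.sum_congr rfl fun j _ => ?_
    simp [hv]
  have hψψ : ∀ i k, inner ℝ (ψ i) (ψ k) = Matrix.diagonal D i k := fun i k => by
    have e : Matrix.diagonal D = Uᵀ * kernelMatrix (rkhsKernel H) x * U := by
      rw [hA, Matrix.mul_assoc, Matrix.mul_assoc _ Uᵀ, hU', Matrix.mul_one, ← Matrix.mul_assoc, hU',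
        Matrix.one_mul]
    rw [e, Matrix.mul_assoc, Matrix.mul_apply]
    simp only [ψ, real_inner_smul_left, real_inner_smul_right, sum_inner, inner_sum,
      inner_kerFun_kerFun, Matrix.mul_apply, kernelMatrix, Matrix.of_apply, Matrix.transpose_apply,
      Finset.mul_sum]
    rw [Finset.sum_comm]
    refine Finset.sum_congr rfl fun j _ => Finset.sum_congr rfl fun l _ => ?_
    have hsq : (√(n : ℝ))⁻¹ * (√(n : ℝ))⁻¹ = (n : ℝ)⁻¹ := by
      rw [← mul_inv, Real.mul_self_sqrt hn0.le]
    rw [← hsq]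
    ring
  -- Thus `(√0)⁻¹ = 0` loses nothing: null directions contribute zero to both claims.
  have hψ0 : ∀ i, D i = 0 → ψ i = 0 := fun i hi => by
    rw [← inner_self_eq_zero (𝕜 := ℝ), hψψ, Matrix.diagonal_apply_eq, hi]
  refine ⟨fun i => (√(D i))⁻¹ * inner ℝ (ψ i) f, ?_, ?_⟩
  · have hon : Orthonormal ℝ fun i : {i // D i ≠ 0} => (√(D i))⁻¹ • ψ i := by
      rw [orthonormal_iff_ite]
      intro i k
      rw [real_inner_smul_left, real_inner_smul_right, hψψ, Matrix.diagonal_apply]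
      have hs : √(D i) ≠ 0 := (Real.sqrt_pos.mpr ((hD i).lt_of_ne' i.2)).ne'
      by_cases hik : i = k
      · subst hik
        rw [if_pos rfl, if_pos rfl, ← mul_assoc, ← mul_inv, Real.mul_self_sqrt (hD i),
          inv_mul_cancel₀ i.2]
      · rw [if_neg hik, if_neg (fun h => hik (Subtype.ext h)), mul_zero, mul_zero]
    have hb := hon.sum_inner_products_le (x := f) (s := Finset.univ)
    rw [sum_eq_sum_subtype_add (fun i => D i ≠ 0),
      Finset.sum_eq_zero fun (i : {i // ¬ D i ≠ 0}) _ => by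
        beta_reduce
        rw [hψ0 i (not_not.mp i.2), inner_zero_left, mul_zero, sq, mul_zero], add_zero]
    refine le_trans (le_of_eq ?_) hb
    refine Finset.sum_congr rfl fun i _ => ?_
    rw [real_inner_smul_left, Real.norm_eq_abs, sq_abs]
  · have h1 : Matrix.diagonal (fun i => √(D i)) *ᵥ (fun i => (√(D i))⁻¹ * inner ℝ (ψ i) f)
        = (√(n : ℝ))⁻¹ • (Uᵀ *ᵥ v) := by
      funext i
      rw [Matrix.mulVec_diagonal, Pi.smul_apply, smul_eq_mul, ← hψf]
      by_cases hi : D i = 0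
      · rw [hψ0 i hi, inner_zero_left, mul_zero, mul_zero]
      · rw [mul_inv_cancel_left₀ (Real.sqrt_pos.mpr ((hD i).lt_of_ne' hi)).ne']
    rw [hC, Matrix.transpose_mul, Matrix.transpose_transpose, Matrix.diagonal_transpose,
      ← Matrix.mulVec_mulVec, h1, Matrix.mulVec_smul, smul_inv_smul₀ hsn, Matrix.mulVec_mulVec, hU,
      Matrix.one_mulVec]

end RKHS

/-! ### The test statistic on the satisfiable event. -/

/-- The test statistic in terms of the vector of fitted values. -/
theorem testStat_eq {X : Type*} {n s : ℕ} (hn : 1 ≤ n) (K : X → X → ℝ) (lam : ℝ) (x : Fin n → X)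
    (S : Matrix (Fin s) (Fin n) ℝ) (y : Fin n → ℝ) :
    testStat K lam x S y = (n : ℝ)⁻¹ * ‖WithLp.toLp 2 ((n : ℝ) •
      (kernelMatrix K x *ᵥ (Sᵀ *ᵥ projCoeff lam (kernelMatrix K x) S y)))‖ ^ 2 := by
  have hn0 : (n : ℝ) ≠ 0 := by positivity
  rw [testStat, empNorm, Real.sq_sqrt (by positivity), EuclideanSpace.real_norm_sq_eq]
  congr 1
  refine Finset.sum_congr rfl fun i _ => ?_
  congr 1
  simp only [projEstimator, Pi.smul_apply, smul_eq_mul]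
  rw [Matrix.mulVec, dotProduct, Finset.mul_sum]
  refine Finset.sum_congr rfl fun j _ => ?_
  rw [kernelMatrix, Matrix.of_apply]
  field_simp

/-- On the satisfiable event, the test statistic is the squared length of a linear contraction `L`
of the responses, with squared bias of order `λ` on balls of the reproducing kernel Hilbert space. -/
theorem IsKSatisfiable.exists_contraction {H X : Type*} [NormedAddCommGroup H]
    [InnerProductSpace ℝ H] [CompleteSpace H] [RKHS ℝ H X ℝ] {n s : ℕ} (hn : 1 ≤ n) {c lam : ℝ}
    (hlam : 0 < lam) {x : Fin n → X} {S : Matrix (Fin s) (Fin n) ℝ}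
    (h : IsKSatisfiable c lam (kernelMatrix (rkhsKernel H) x) S) :
    ∃ L : EuclideanSpace ℝ (Fin n) →ₗ[ℝ] EuclideanSpace ℝ (Fin n),
      (∀ v, ‖L v‖ ≤ ‖v‖) ∧
      (∀ y, testStat (rkhsKernel H) lam x S y = (n : ℝ)⁻¹ * ‖L (WithLp.toLp 2 y)‖ ^ 2) ∧
      ∀ f : H, ‖WithLp.toLp 2 (fun i => f (x i)) - L (WithLp.toLp 2 fun i => f (x i))‖ ^ 2
        ≤ n * lam * (3 + 6 * c ^ 2) * ‖f‖ ^ 2 := by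
  obtain ⟨U, D, hU, -, hD, hA, h₁, h₂⟩ := h
  obtain ⟨C, hC⟩ : ∃ C, C = Matrix.diagonal (fun i => √(D i)) * Uᵀ := ⟨_, rfl⟩
  have hAC : kernelMatrix (rkhsKernel H) x = Cᵀ * C := by
    have hDD : Matrix.diagonal D
        = Matrix.diagonal (fun i => √(D i)) * Matrix.diagonal (fun i => √(D i)) := by
      rw [Matrix.diagonal_mul_diagonal]
      simp_rw [Real.mul_self_sqrt (hD _)]
    rw [hA, hDD, hC, Matrix.transpose_mul, Matrix.transpose_transpose, Matrix.diagonal_transpose]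
    simp only [Matrix.mul_assoc]
  obtain ⟨L, hL, hbias, hfit⟩ := exists_fittedValues hn hlam.le hAC S
  refine ⟨L, hL, fun y => by rw [testStat_eq hn, hfit], fun f => ?_⟩
  obtain ⟨g, hg, hfg⟩ := exists_values_eq_mulVec x hU hD hA hC f
  obtain ⟨β, hβ⟩ := exists_coeff_approx hlam hU hD h₁ h₂ hC g
  rw [hfg]
  have h3 := hbias (WithLp.toLp 2 (Cᵀ *ᵥ g)) β
  rw [hAC, ← Matrix.mulVec_mulVec] at h3
  rw [WithLp.toLp_smul, map_smul, ← smul_sub, norm_smul, mul_pow, Real.norm_eq_abs, sq_abs,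
    Real.sq_sqrt (Nat.cast_nonneg n), mul_assoc, mul_assoc]
  refine mul_le_mul_of_nonneg_left ?_ (Nat.cast_nonneg n)
  rw [← mul_assoc]
  exact (h3.trans hβ).trans (mul_le_mul_of_nonneg_left hg (by positivity))

/-! ### Events of `(a, b)`-type. -/

theorem expNeg_nonneg (a : ℝ≥0∞) : 0 ≤ expNeg a := by
  unfold expNeg; split_ifs
  · exact le_rfl
  · positivity

theorem expNeg_le_one (a : ℝ≥0∞) : expNeg a ≤ 1 := by
  unfold expNeg; split_ifs
  · exact zero_le_one
  · exact Real.exp_le_one_iff.mpr (neg_nonpos.mpr ENNReal.toReal_nonneg)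

/-- An event of `(a, b)`-type contains a measurable event of probability at least
`1 - exp(-a) - exp(-b)`.  Measurability of the event itself is not required. -/
theorem IsEventType.exists_measurableSet {Ω E : Type*} [MeasurableSpace Ω] [mE : MeasurableSpace E]
    {P : Measure Ω} [IsProbabilityMeasure P] {x : Ω → E} (hx : Measurable x) {A : Set Ω}
    {a b : ℝ≥0∞} (h : IsEventType P x A a b) :
    ∃ B ⊆ A, MeasurableSet B ∧ 1 - expNeg a - expNeg b ≤ P.real B := by
  have ha0 := expNeg_nonneg a
  have ha1 := expNeg_le_one a
  have hb0 := expNeg_nonneg b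
  have hb1 := expNeg_le_one b
  by_cases hint : Integrable (A.indicator fun _ => (1 : ℝ)) P
  · have hnull : NullMeasurableSet A P := by
      have h1 : A = A.indicator (fun _ => (1 : ℝ)) ⁻¹' {1} := by
        ext ω
        by_cases hω : ω ∈ A <;> simp [hω]
      rw [h1]
      exact hint.aemeasurable.nullMeasurable (measurableSet_singleton 1)
    obtain ⟨B, hBA, hB, hBeq⟩ := hnull.exists_measurable_subset_ae_eq
    refine ⟨B, hBA, hB, ?_⟩
    -- Markov for the conditional probability, whose mean is `P(A) = P(B)`: `(1 - e⁻ᵃ)(1 - e⁻ᵇ) ≤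
    -- P(B)`.
    have hmark := mul_meas_ge_le_integral_of_nonneg (μ := P)
      (f := P⟦A | MeasurableSpace.comap x mE⟧)
      (condExp_nonneg (ae_of_all _ fun ω => Set.indicator_nonneg (fun _ _ => zero_le_one) ω))
      integrable_condExp (1 - expNeg a)
    rw [integral_condExp hx.comap_le] at hmark
    have hPA : ∫ ω, A.indicator (fun _ => (1 : ℝ)) ω ∂P = P.real B := by
      rw [← integral_indicator_one hB]
      exact integral_congr_ae (indicator_ae_eq_of_ae_eq_set hBeq.symm)
    rw [hPA] at hmark
    have h' : 1 - expNeg b ≤ P.real {ω | 1 - expNeg a ≤ (P⟦A | MeasurableSpace.comap x mE⟧) ω} := h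
    have := mul_le_mul_of_nonneg_left h' (sub_nonneg.mpr ha1)
    nlinarith [mul_nonneg ha0 hb0]
  -- Here the conditional probability takes the default value `0`. The hypothesis then forces
  -- `expNeg a ≥ 1` or `expNeg b ≥ 1`, so the required bound is at most `0`.
  · refine ⟨∅, Set.empty_subset _, MeasurableSet.empty, ?_⟩
    have h' : 1 - expNeg b ≤ P.real {ω | 1 - expNeg a ≤ (P⟦A | MeasurableSpace.comap x mE⟧) ω} := h
    rw [condExp_of_not_integrable hint] at h'
    rw [measureReal_empty]
    rcases lt_or_ge (0 : ℝ) (1 - expNeg a) with h0 | h0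
    · have : {ω : Ω | 1 - expNeg a ≤ (0 : Ω → ℝ) ω} = ∅ := by
        ext ω; simpa using h0
      rw [this, measureReal_empty] at h'
      linarith
    · linarith

/-! ### Chebyshev bounds for Gaussian noise. -/

theorem meas_real_ge_le_variance_div_sq {Ω : Type*} [MeasurableSpace Ω] {μ : Measure Ω}
    [IsFiniteMeasure μ] {Y : Ω → ℝ} (hY : MemLp Y 2 μ) {r : ℝ} (hr : 0 < r) :
    μ.real {ω | r ≤ |Y ω - μ[Y]|} ≤ variance Y μ / r ^ 2 :=
  ENNReal.toReal_le_of_le_ofReal (div_nonneg (variance_nonneg _ _) (sq_nonneg _))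
    (meas_ge_le_variance_div_sq hY hr)

/-- The standard Gaussian law on `ℝⁿ`, the law of the noise. -/
noncomputable abbrev noiseLaw (n : ℕ) : Measure (Fin n → ℝ) :=
  Measure.pi fun _ : Fin n => gaussianReal 0 1

theorem memLp_eval_noiseLaw {n : ℕ} (p : ℝ≥0∞) (hp : p ≠ ∞) (i : Fin n) :
    MemLp (fun e : Fin n → ℝ => e i) p (noiseLaw n) :=
  (memLp_id_gaussianReal' (μ := 0) (v := 1) p hp).comp_measurePreserving
    (measurePreserving_eval (fun _ : Fin n => gaussianReal 0 1) i)

theorem memLp_dotProduct_noiseLaw {n : ℕ} (p : ℝ≥0∞) (hp : p ≠ ∞) (a : Fin n → ℝ) :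
    MemLp (fun e : Fin n → ℝ => a ⬝ᵥ e) p (noiseLaw n) :=
  memLp_finsetSum _ fun i _ => (memLp_eval_noiseLaw p hp i).const_mul (a i)

theorem integral_dotProduct_noiseLaw {n : ℕ} (a : Fin n → ℝ) :
    ∫ e, a ⬝ᵥ e ∂(noiseLaw n) = 0 := by
  simp only [dotProduct]
  rw [integral_finsetSum _ fun i _ =>
    ((memLp_eval_noiseLaw 1 ENNReal.one_ne_top i).integrable le_rfl).const_mul (a i)]
  refine Finset.sum_eq_zero fun i _ => ?_
  rw [integral_const_mul]
  have h := integral_comp_eval (μ := fun _ : Fin n => gaussianReal 0 1) (i := i) (f := fun t => t)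
    aestronglyMeasurable_id
  rw [h, integral_id_gaussianReal, mul_zero]

theorem variance_dotProduct_noiseLaw {n : ℕ} (a : Fin n → ℝ) :
    variance (fun e => a ⬝ᵥ e) (noiseLaw n) = ‖WithLp.toLp 2 a‖ ^ 2 := by
  have h := variance_sum_pi (μ := fun _ : Fin n => gaussianReal 0 1)
    (X := fun i t => a i * id t) fun i => (memLp_id_gaussianReal' 2 (by simp)).const_mul (a i)
  have e : (fun e : Fin n → ℝ => a ⬝ᵥ e) = ∑ i, fun e : Fin n → ℝ => a i * id (e i) := by
    funext e
    simp [dotProduct]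
  rw [e, h, EuclideanSpace.real_norm_sq_eq]
  refine Finset.sum_congr rfl fun i _ => ?_
  rw [variance_const_mul, variance_id_gaussianReal]
  simp

theorem linearMap_apply_eq_dotProduct {n : ℕ}
    (l : EuclideanSpace ℝ (Fin n) →ₗ[ℝ] ℝ) (e : Fin n → ℝ) :
    l (WithLp.toLp 2 e) = (fun i => l (EuclideanSpace.single i 1)) ⬝ᵥ e := by
  have h : WithLp.toLp 2 e = ∑ i, e i • EuclideanSpace.single i (1 : ℝ) := by
    ext j
    simp [Pi.single_apply]
  rw [h, map_sum]
  refine Finset.sum_congr rfl fun i _ => ?_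
  rw [map_smul, smul_eq_mul, mul_comm]

/-- Gaussian linear forms have fourth moments, so their squares are in `L²`; this lets Chebyshev
apply to the statistic itself. -/
theorem memLp_norm_sq_noiseLaw {n : ℕ}
    (L : EuclideanSpace ℝ (Fin n) →ₗ[ℝ] EuclideanSpace ℝ (Fin n)) :
    MemLp (fun e => ‖L (WithLp.toLp 2 e)‖ ^ 2) 2 (noiseLaw n) := by
  simp only [EuclideanSpace.real_norm_sq_eq]
  refine memLp_finsetSum _ fun j _ => ?_
  have h : MemLp (fun e => (L (WithLp.toLp 2 e)) j) 4 (noiseLaw n) := by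
    have e : (fun e => (L (WithLp.toLp 2 e)) j) = fun e =>
        (fun i => ((EuclideanSpace.proj j : EuclideanSpace ℝ (Fin n) →L[ℝ] ℝ).toLinearMap ∘ₗ L)
          (EuclideanSpace.single i 1)) ⬝ᵥ e := by
      funext e
      exact linearMap_apply_eq_dotProduct
        ((EuclideanSpace.proj j : EuclideanSpace ℝ (Fin n) →L[ℝ] ℝ).toLinearMap ∘ₗ L) e
    rw [e]
    exact memLp_dotProduct_noiseLaw 4 (by simp) _
  have : ENNReal.HolderTriple 4 4 2 := ⟨by
    rw [← two_mul, show (4 : ℝ≥0∞) = 2 * 2 by norm_num,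
      ENNReal.mul_inv (Or.inl (by simp)) (Or.inl (by simp)), ← mul_assoc,
      ENNReal.mul_inv_cancel (by simp) (by simp), one_mul]⟩
  simp only [sq]
  exact h.mul h

/-- The linear functional `e ↦ ⟪u, L e⟫` of the noise, with `L` a contraction, exceeds `r ‖u‖`
with probability at most `1 / r²`. -/
theorem noiseLaw_real_inner_ge_le {n : ℕ}
    {L : EuclideanSpace ℝ (Fin n) →ₗ[ℝ] EuclideanSpace ℝ (Fin n)} (hL : ∀ v, ‖L v‖ ≤ ‖v‖)
    {u : EuclideanSpace ℝ (Fin n)} (hu : u ≠ 0) {r : ℝ} (hr : 0 < r) :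
    (noiseLaw n).real {e | r * ‖u‖ ≤ |inner ℝ u (L (WithLp.toLp 2 e))|} ≤ 1 / r ^ 2 := by
  have hu' : 0 < ‖u‖ := norm_pos_iff.mpr hu
  set a : EuclideanSpace ℝ (Fin n) := L.adjoint u with ha
  have hin : ∀ e, inner ℝ u (L (WithLp.toLp 2 e)) = a.ofLp ⬝ᵥ e := fun e => by
    rw [← LinearMap.adjoint_inner_left, ← ha]
    conv_lhs => rw [← WithLp.toLp_ofLp 2 a]
    rw [EuclideanSpace.inner_toLp_toLp, star_trivial, dotProduct_comm]
  -- The adjoint of a contraction is a contraction.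
  have hau : ‖a‖ ≤ ‖u‖ := by
    rcases (norm_nonneg a).eq_or_lt with h | h
    · rw [← h]; exact hu'.le
    refine le_of_mul_le_mul_right ?_ h
    calc ‖a‖ * ‖a‖ = inner ℝ a a := (real_inner_self_eq_norm_mul_norm a).symm
      _ = inner ℝ u (L a) := by rw [← LinearMap.adjoint_inner_left L, ← ha]
      _ ≤ ‖u‖ * ‖L a‖ := real_inner_le_norm _ _
      _ ≤ ‖u‖ * ‖a‖ := mul_le_mul_of_nonneg_left (hL a) hu'.le
  have h := meas_real_ge_le_variance_div_sq (memLp_dotProduct_noiseLaw 2 (by simp) a.ofLp)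
    (mul_pos hr hu')
  rw [integral_dotProduct_noiseLaw, variance_dotProduct_noiseLaw, WithLp.toLp_ofLp] at h
  simp only [sub_zero, ← hin] at h
  refine h.trans ?_
  rw [div_le_div_iff₀ (by positivity) (by positivity), mul_pow]
  nlinarith [pow_le_pow_left₀ (norm_nonneg a) hau 2, sq_nonneg r]

theorem measurable_norm_sq_linearMap {n : ℕ}
    (L : EuclideanSpace ℝ (Fin n) →ₗ[ℝ] EuclideanSpace ℝ (Fin n)) :
    Measurable fun e : Fin n → ℝ => ‖L (WithLp.toLp 2 e)‖ ^ 2 := by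
  have hL : Continuous L := LinearMap.continuous_of_finiteDimensional L
  have : Continuous fun e : Fin n → ℝ => ‖L (WithLp.toLp 2 e)‖ ^ 2 :=
    ((hL.comp (PiLp.continuous_toLp 2 _)).norm.pow 2)
  exact this.measurable

/-! ### Power of the test. -/

/-- Power of the test when the statistic is the squared length of a linear contraction `L` of the
responses: it suffices that the signal `L v` dominates the null standard deviation and `1`. -/
theorem condPower_ge {X : Type*} {n s : ℕ} (hn : 1 ≤ n) {K : X → X → ℝ} {lam : ℝ}
    (hlam : 0 < lam) {x : Fin n → X} {S : Matrix (Fin s) (Fin n) ℝ}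
    {L : EuclideanSpace ℝ (Fin n) →ₗ[ℝ] EuclideanSpace ℝ (Fin n)} (hL : ∀ v, ‖L v‖ ≤ ‖v‖)
    (hT : ∀ y, testStat K lam x S y = (n : ℝ)⁻¹ * ‖L (WithLp.toLp 2 y)‖ ^ 2)
    {α r : ℝ} (hr : 0 < r) {f : X → ℝ} (hu : L (WithLp.toLp 2 fun i => f (x i)) ≠ 0)
    (hsig : n * ((|stdNormalQuantile (1 - α / 2)| + r) * (lam + nullSd K lam x S))
      ≤ ‖L (WithLp.toLp 2 fun i => f (x i))‖ ^ 2
        - 2 * r * ‖L (WithLp.toLp 2 fun i => f (x i))‖) :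
    1 - 2 / r ^ 2 ≤ condPower α K lam f x S := by
  have hn0 : (0 : ℝ) < n := by exact_mod_cast hn
  set v := WithLp.toLp 2 fun i => f (x i) with hv
  set u := L v with hu_def
  set q := stdNormalQuantile (1 - α / 2) with hq
  set σ := nullSd K lam x S with hσ
  have hσ0 : 0 ≤ σ := Real.sqrt_nonneg _
  have hTm : Measurable (testStat K lam x S) := by
    rw [funext hT]
    exact (measurable_norm_sq_linearMap L).const_mul _
  have hnull : condLaw (fun _ => 0) x = noiseLaw n := by simp [condLaw]
  have hTL : MemLp (testStat K lam x S) 2 (noiseLaw n) := by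
    rw [funext hT]
    exact (memLp_norm_sq_noiseLaw L).const_mul _
  have hvar : variance (testStat K lam x S) (noiseLaw n) = σ ^ 2 := by
    rw [hσ, nullSd, Real.sq_sqrt (variance_nonneg _ _), hnull]
  have hmean : ∫ y, testStat K lam x S y ∂(noiseLaw n) = nullMean K lam x S := by
    rw [nullMean, hnull]
  -- The threshold uses `lam + σ` instead of `σ` to stay positive when `σ = 0`.
  have hb₁ : (noiseLaw n).real {e | r * (lam + σ) ≤ |testStat K lam x S e - nullMean K lam x S|}
      ≤ 1 / r ^ 2 := by
    have h := meas_real_ge_le_variance_div_sq hTL (mul_pos hr (add_pos_of_pos_of_nonneg hlam hσ0))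
    rw [hmean, hvar] at h
    refine h.trans ?_
    rw [div_le_div_iff₀ (by positivity) (by positivity), mul_pow]
    nlinarith [pow_le_pow_left₀ hσ0 (le_add_of_nonneg_left hlam.le : σ ≤ lam + σ) 2, sq_nonneg r]
  have hb₂ := noiseLaw_real_inner_ge_le hL hu hr
  have hrej : MeasurableSet {y | Rejects α K lam x S y} :=
    measurableSet_le measurable_const (hTm.sub_const _).abs
  have hshift : Measurable fun (e : Fin n → ℝ) i => f (x i) + e i :=
    measurable_pi_lambda _ fun i => (measurable_pi_apply i).const_add _
  -- Failure to reject forces one of the two Chebyshev deviations.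
  have hsub : ((fun (e : Fin n → ℝ) i => f (x i) + e i) ⁻¹' {y | Rejects α K lam x S y})ᶜ ⊆
      {e | r * (lam + σ) ≤ |testStat K lam x S e - nullMean K lam x S|} ∪
        {e | r * ‖u‖ ≤ |inner ℝ u (L (WithLp.toLp 2 e))|} := by
    intro e he
    by_contra hcon
    rw [Set.mem_union, not_or, Set.mem_ofPred_eq, Set.mem_ofPred_eq, not_le, not_le] at hcon
    obtain ⟨h1, h2⟩ := hcon
    refine he ?_
    have hy : L (WithLp.toLp 2 fun i => f (x i) + e i) = u + L (WithLp.toLp 2 e) := by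
      rw [hu_def, hv, ← map_add]; rfl
    have hTy : testStat K lam x S (fun i => f (x i) + e i)
        = (n : ℝ)⁻¹ * (‖u‖ ^ 2 + 2 * inner ℝ u (L (WithLp.toLp 2 e))) + testStat K lam x S e := by
      rw [hT, hT, hy, norm_add_sq_real]
      ring
    have h1' := (abs_lt.mp h1).1
    have h2' := (abs_lt.mp h2).1
    have hmain : (|q| + r) * (lam + σ)
        ≤ (n : ℝ)⁻¹ * (‖u‖ ^ 2 + 2 * inner ℝ u (L (WithLp.toLp 2 e))) := by
      rw [inv_mul_eq_div, le_div_iff₀ hn0]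
      linarith
    have hqσ : q * σ ≤ |q| * (lam + σ) :=
      mul_le_mul (le_abs_self q) (by linarith) hσ0 (abs_nonneg q)
    change q * σ ≤ |testStat K lam x S (fun i => f (x i) + e i) - nullMean K lam x S|
    refine le_trans ?_ (le_abs_self _)
    rw [hTy]
    linarith
  have hP : condPower α K lam f x S = (noiseLaw n).real
      ((fun (e : Fin n → ℝ) i => f (x i) + e i) ⁻¹' {y | Rejects α K lam x S y}) := by
    rw [condPower, condLaw, map_measureReal_apply hshift hrej]
  rw [hP]
  have hcompl := probReal_compl_eq_one_sub (μ := noiseLaw n) (hshift hrej)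
  have h1 := (measureReal_mono (μ := noiseLaw n) hsub).trans (measureReal_union_le _ _)
  have : 2 / r ^ 2 = 1 / r ^ 2 + 1 / r ^ 2 := by ring
  linarith

/-- On the satisfiable event the test has power at least `1 - 2 / r²` uniformly over the elements of
a ball of the reproducing kernel Hilbert space separated from zero at the rate `sepRate`. -/
theorem IsKSatisfiable.condPower_ge {H X : Type*} [NormedAddCommGroup H] [InnerProductSpace ℝ H]
    [CompleteSpace H] [RKHS ℝ H X ℝ] {n s : ℕ} (hn : 1 ≤ n) {c lam : ℝ} (hlam : 1 / (n : ℝ) < lam)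
    {x : Fin n → X} {S : Matrix (Fin s) (Fin n) ℝ}
    (h : IsKSatisfiable c lam (kernelMatrix (rkhsKernel H) x) S) {α r R : ℝ} (hr : 0 < r)
    {f : H} (hf : ‖f‖ ≤ R)
    (hsep : (3 * r + |stdNormalQuantile (1 - α / 2)| + 1 + √(3 + 6 * c ^ 2) * R)
      * sepRate (rkhsKernel H) lam x S ≤ empNorm x f) :
    1 - 2 / r ^ 2 ≤ condPower α (rkhsKernel H) lam f x S := by
  have hn0 : (0 : ℝ) < n := by exact_mod_cast hn
  have hlam0 : 0 < lam := (by positivity : (0 : ℝ) < 1 / n).trans hlam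
  obtain ⟨L, hL, hT, hbias⟩ := h.exists_contraction hn hlam0
  specialize hbias f
  set q := |stdNormalQuantile (1 - α / 2)| with hq
  have hq0 : 0 ≤ q := abs_nonneg _
  set v := WithLp.toLp 2 fun i => f (x i) with hv
  set σ := nullSd (rkhsKernel H) lam x S with hσ
  have hσ0 : 0 ≤ σ := Real.sqrt_nonneg _
  have hR : 0 ≤ R := (norm_nonneg f).trans hf
  -- The separation rate on the unnormalized scale `√n · empNorm`, where it compares directly with
  -- `‖v‖`.
  set ρ := √(n * (lam + σ)) with hρ
  have hρ1 : 1 ≤ ρ := by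
    rw [hρ, Real.one_le_sqrt]
    have h1 : 1 ≤ lam * n := ((div_lt_iff₀ hn0).mp hlam).le
    nlinarith
  have hemp : √(n : ℝ) * empNorm x f = ‖v‖ := by
    rw [empNorm, ← Real.sqrt_mul hn0.le, mul_inv_cancel_left₀ hn0.ne']
    rw [← Real.sqrt_sq (norm_nonneg v), EuclideanSpace.real_norm_sq_eq]
  have hρs : √(n : ℝ) * sepRate (rkhsKernel H) lam x S = ρ := by
    rw [sepRate, ← Real.sqrt_mul hn0.le]
  have hb : ‖v - L v‖ ≤ √(3 + 6 * c ^ 2) * R * ρ := by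
    refine le_of_sq_le_sq (hbias.trans ?_) (by positivity)
    rw [mul_pow, mul_pow, Real.sq_sqrt (by positivity), hρ, Real.sq_sqrt (by positivity)]
    have h1 : ‖f‖ ^ 2 ≤ R ^ 2 := pow_le_pow_left₀ (norm_nonneg f) hf 2
    have h2 : n * lam ≤ n * (lam + σ) := mul_le_mul_of_nonneg_left (by linarith) hn0.le
    calc n * lam * (3 + 6 * c ^ 2) * ‖f‖ ^ 2 = (n * lam) * ((3 + 6 * c ^ 2) * ‖f‖ ^ 2) := by ring
      _ ≤ (n * (lam + σ)) * ((3 + 6 * c ^ 2) * R ^ 2) :=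
        mul_le_mul h2 (mul_le_mul_of_nonneg_left h1 (by positivity)) (by positivity) (by positivity)
      _ = _ := by ring
  have hLv : (3 * r + q + 1) * ρ ≤ ‖L v‖ := by
    have h1 := mul_le_mul_of_nonneg_left hsep (Real.sqrt_nonneg (n : ℝ))
    rw [hemp, mul_left_comm, hρs] at h1
    have h2 := norm_sub_norm_le v (L v)
    linarith
  refine RandProjTest.condPower_ge hn hlam0 hL hT hr
    (norm_pos_iff.mp (lt_of_lt_of_le (by positivity) hLv)) ?_
  have hρ2 : n * ((q + r) * (lam + σ)) = (q + r) * ρ ^ 2 := by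
    rw [hρ, Real.sq_sqrt (by positivity)]
    ring
  rw [← hv, ← hσ, ← hq, hρ2]
  -- Since `ρ ≥ 1`, the cross term `2r` is at most `2rρ`; this is what the `3r` in the constant pays
  -- for.
  have hA : (r + q + 1) * ρ ≤ ‖L v‖ - 2 * r := by nlinarith
  have hB : (q + r) * ρ ≤ ‖L v‖ := by nlinarith
  calc (q + r) * ρ ^ 2 ≤ ((q + r) * ρ) * ((r + q + 1) * ρ) := by
        have : 0 ≤ (q + r) * ρ ^ 2 * (r + q) := by positivity
        nlinarith
    _ ≤ ‖L v‖ * (‖L v‖ - 2 * r) :=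
        mul_le_mul hB hA (by positivity) (norm_nonneg _)
    _ = _ := by ring

end RandProjTest

/-! ### The theorem. -/

open RandProjTest in
theorem theorem4p6
    {d : ℕ} (hd : 1 ≤ d) (𝒳 : Set (EuclideanSpace ℝ (Fin d)))
    -- the reproducing kernel Hilbert space, its kernel and the spectral expansion of the kernel
    {H : Type*} [NormedAddCommGroup H] [InnerProductSpace ℝ H] [CompleteSpace H] [RKHS ℝ H 𝒳 ℝ]
    (PX : Measure 𝒳) [IsProbabilityMeasure PX] (μ : ℕ → ℝ) (φ : ℕ → 𝒳 → ℝ)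
    (hK : IsMercerExpansion (rkhsKernel H) PX μ φ) (hA1 : EigenRegularity μ φ)
    -- i.i.d. design points and random projection matrices (which may depend on the design)
    {Ω : Type*} [MeasurableSpace Ω] (P : Measure Ω) [IsProbabilityMeasure P]
    (x : ∀ n : ℕ, Ω → Fin n → 𝒳) (hx : ∀ n, Measurable (x n))
    (hxlaw : ∀ n, P.map (x n) = Measure.pi fun _ : Fin n => PX)
    (s : ℕ → ℕ) (S : ∀ n : ℕ, Ω → Matrix (Fin (s n)) (Fin n) ℝ)
    (hS : ∀ n i j, Measurable fun ω => S n ω i j)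
    -- the smoothing parameter
    (lam : ℕ → ℝ) (hlam : ∀ n : ℕ, 1 ≤ n → 1 / (n : ℝ) < lam n)
    (hlam0 : Tendsto lam atTop (𝓝 0))
    -- enough projections, and `K`-satisfiability with high probability
    (δ : ℝ) (hδ : 0 < δ) (hA2a : ∀ n : ℕ, 1 ≤ n → δ * effDim μ (lam n) ≤ s n)
    (c : ℝ) (hc : 0 < c) (c₁ c₂ : ℝ≥0∞) (hc₁ : 0 < c₁) (hc₂ : 0 < c₂)
    (hA2b : ∀ n : ℕ, 1 ≤ n → IsEventType P (x n)
      {ω | IsKSatisfiable c (lam n) (kernelMatrix (rkhsKernel H) (x n ω)) (S n ω)}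
      (c₁ * s n) (c₂ * effDim μ (lam n)))
    -- the level of the test and the radius of the ball of alternatives
    (α : ℝ) (hα0 : 0 < α) (hα1 : α < 1) (R : ℝ) (hR : 0 < R) :
    ∀ ε : ℝ, 0 < ε → ∃ Cε : ℝ, 0 < Cε ∧ ∃ Nε : ℕ, 0 < Nε ∧ ∀ n : ℕ, Nε ≤ n →
      ∃ E : Set Ω, MeasurableSet E ∧
        1 - expNeg (c₁ * s n) - expNeg (c₂ * effDim μ (lam n)) ≤ P.real E ∧
        ∀ ω ∈ E, ∀ f : H, ‖f‖ ≤ R →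
          Cε * sepRate (rkhsKernel H) (lam n) (x n ω) (S n ω) ≤ empNorm (x n ω) f →
          1 - ε ≤ condPower α (rkhsKernel H) (lam n) f (x n ω) (S n ω) := by
  intro ε hε
  -- Two Chebyshev failures of probability at most `1/r²` each add up to `ε`.
  set r := √(2 / ε) with hr
  have hr0 : 0 < r := Real.sqrt_pos.mpr (by positivity)
  have hrε : 2 / r ^ 2 = ε := by
    rw [hr, Real.sq_sqrt (by positivity)]
    field_simp
  -- The last summand absorbs the bias, the rest keeps `L v` large. The bound is nonasymptotic, so
  -- `Nε = 1`.
  refine ⟨3 * r + |stdNormalQuantile (1 - α / 2)| + 1 + √(3 + 6 * c ^ 2) * R, by positivity, 1,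
    one_pos, fun n hn => ?_⟩
  obtain ⟨E, hEsub, hE, hPE⟩ := (hA2b n hn).exists_measurableSet (hx n)
  refine ⟨E, hE, hPE, fun ω hω f hf hsep => ?_⟩
  rw [← hrε]
  exact (hEsub hω).condPower_ge hn (hlam n hn) hr0 hf hsep
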